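/- Let $Y$ be a (real or complex) Hilbert space, let $m$ be a positive integer and let $r\ge 2$ be a real number. For $k\ge1$ let $r_k(t)=\operatorname{sign}(\sin(2^k\pi t))$, $t\in[0,1]$, denote the Rademacher functions. Then for every positive integer $n$ and every array $(y_{i_1,\dots,i_m})_{i_1,\dots,i_m=1}^{n}$ in $Y$, $$\Big(\sum_{i_1,\dots,i_m=1}^{n}\|y_{i_1,\dots,i_m}\|^{r}\Big)^{1/r}\le 2^{m/r}\int_{[0,1]^m}\Big\|\sum_{i_1,\dots,i_m=1}^{n} r_{i_1}(t_1)\cdots r_{i_m}(t_m)\,y_{i_1,\dots,i_m}\Big\|\,dt_1\cdots dt_m .$$ Moreover, the constant $2^{m/r}$ is optimal: if $Y\ne\{0\}$ and $C$ is a real number such that the inequality with $C$ in place of $2^{m/r}$ holds for all positive integers $n$ and all arrays $(y_{i_1,\dots,i_m})_{i_1,\dots,i_m=1}^{n}$ in $Y$, then $C\ge 2^{m/r}$. -/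

import Mathlib

open MeasureTheory

noncomputable section

/-- The Rademacher function `r_k(t) = sign (sin (2 ^ k * π * t))`, used for `k ≥ 1` and `t ∈ [0, 1]`. -/
def rademacher (k : ℕ) (t : ℝ) : ℝ :=
  Real.sign (Real.sin ((2 : ℝ) ^ k * Real.pi * t))

/-- The multiple Rademacher sum
`∑_{i₁, …, i_m = 1}^n r_{i₁}(t₁) ⋯ r_{i_m}(t_m) y_{i₁, …, i_m}` at the point `t = (t₁, …, t_m)`.
The index `i j : Fin n` runs over `0, …, n - 1`, whence the shift by one. -/
def rademacherChaos (𝕜 : Type*) [RCLike 𝕜] {Y : Type*} [NormedAddCommGroup Y]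
    [InnerProductSpace 𝕜 Y] {m n : ℕ} (y : (Fin m → Fin n) → Y) (t : Fin m → ℝ) : Y :=
  ∑ i : Fin m → Fin n,
    ((∏ j : Fin m, rademacher ((i j : ℕ) + 1) (t j) : ℝ) : 𝕜) • y i

/-- The `L₁` norm over `[0, 1]^m` (Lebesgue measure) of the multiple Rademacher sum. -/
def rademacherChaosL1 (𝕜 : Type*) [RCLike 𝕜] {Y : Type*} [NormedAddCommGroup Y]
    [InnerProductSpace 𝕜 Y] {m n : ℕ} (y : (Fin m → Fin n) → Y) : ℝ :=
  ∫ t in (Set.Icc 0 1 : Set (Fin m → ℝ)), ‖rademacherChaos 𝕜 y t‖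

/-- The `ℓ_r` sum of the norms of the entries of an array. -/
def arrayNorm {Y : Type*} [NormedAddCommGroup Y] {m n : ℕ} (r : ℝ)
    (y : (Fin m → Fin n) → Y) : ℝ :=
  (∑ i : Fin m → Fin n, ‖y i‖ ^ r) ^ (1 / r)

theorem measurable_rademacher (k : ℕ) : Measurable (rademacher k) := by
  have h : Measurable Real.sign :=
    Measurable.ite measurableSet_Iio measurable_const
      (Measurable.ite measurableSet_Ioi measurable_const measurable_const)
  exact h.comp (by fun_prop)

theorem abs_rademacher_le_one (k : ℕ) (t : ℝ) : |rademacher k t| ≤ 1 := by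
  unfold rademacher
  rcases Real.sign_apply_eq (Real.sin ((2 : ℝ) ^ k * Real.pi * t)) with h | h | h <;>
    rw [h] <;> norm_num

/-- The integral in `rademacherChaosL1` is a genuine one. -/
theorem integrableOn_norm_rademacherChaos (𝕜 : Type*) [RCLike 𝕜] {Y : Type*}
    [NormedAddCommGroup Y] [InnerProductSpace 𝕜 Y] {m n : ℕ} (y : (Fin m → Fin n) → Y) :
    IntegrableOn (fun t => ‖rademacherChaos 𝕜 y t‖) (Set.Icc 0 1 : Set (Fin m → ℝ)) := by
  refine Integrable.norm ?_
  unfold rademacherChaos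
  refine integrable_finsetSum _ fun i _ => Integrable.smul_const ?_ (y i)
  refine Integrable.ofReal ?_
  have hmeas : Measurable fun t : Fin m → ℝ =>
      ∏ j : Fin m, rademacher ((i j : ℕ) + 1) (t j) :=
    Finset.measurable_prod _ fun j _ => (measurable_rademacher _).comp (measurable_pi_apply j)
  refine Measure.integrableOn_of_bounded (M := 1) ?_ hmeas.aestronglyMeasurable ?_
  · exact (isCompact_Icc.measure_lt_top).ne
  · refine Filter.Eventually.of_forall fun t => ?_
    rw [Real.norm_eq_abs, Finset.abs_prod]
    exact Finset.prod_le_one (fun _ _ => abs_nonneg _) fun j _ => abs_rademacher_le_one _ _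

end

/-! Almost everywhere the Rademacher functions are signs of binary digits, which are independent and
uniform. The integral is therefore a finite average over sign choices, `signChaosMean`
(`rademacherChaosL1_eq_signChaosMean`).

The bound interpolates between two endpoints. At infinity, every entry is bounded by the mean with
constant 1 (`norm_le_signChaosMean`). At exponent 2, the constant is `2 ^ (m / 2)`
(`sum_sq_norm_le_signChaosMean`). The latter is an induction on `m`. Orthogonality of signs in a
Hilbert space turns the square sum into a second moment, and Kahane's inequality with constant √2
passes to the first moment, at the cost of one factor 2 per index. Kahane's inequality is applied to
vectors in an ℓ² sum of copies of the space, so a vector-valued version is needed.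

Kahane's inequality (`expect_sq_norm_signSum_le`) follows the argument of Latała and Oleszkiewicz:
the norm of a signed sum is even, and its averages over single sign changes are controlled from
below by the triangle inequality. Walsh expansion converts these two facts into the moment
comparison.

Constant arrays with `n = 2` give equality, hence optimality. -/

open scoped BigOperators

noncomputable section

/-! ### Walsh analysis on the sign cube -/

section Walsh

variable {ι : Type*}

/-- The Walsh function `∏ i ∈ S, x i` on the sign cube. -/
def walsh (S : Finset ι) (x : ι → ℤˣ) : ℝ := ∏ i ∈ S, ((x i : ℤ) : ℝ)

theorem walsh_neg (S : Finset ι) (x : ι → ℤˣ) : walsh S (-x) = (-1) ^ S.card * walsh S x := by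
  simp [walsh, Finset.prod_neg]

variable [DecidableEq ι]

/-- The point obtained from `x` by changing the sign of the coordinate `i`. -/
def flipSign (i : ι) (x : ι → ℤˣ) : ι → ℤˣ := Function.update x i (-x i)

theorem flipSign_flipSign (i : ι) (x : ι → ℤˣ) : flipSign i (flipSign i x) = x := by
  simp [flipSign]

/-- Changing the sign of a coordinate, as a permutation of the sign cube. -/
def flipSignEquiv (i : ι) : (ι → ℤˣ) ≃ (ι → ℤˣ) where
  toFun := flipSign i
  invFun := flipSign i
  left_inv := flipSign_flipSign i
  right_inv := flipSign_flipSign i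

theorem signCast_mul_self (u : ℤˣ) : ((u : ℤ) : ℝ) * ((u : ℤ) : ℝ) = 1 := by
  rcases Int.units_eq_one_or u with rfl | rfl <;> simp

theorem walsh_flipSign (S : Finset ι) (i : ι) (x : ι → ℤˣ) :
    walsh S (flipSign i x) = (if i ∈ S then -1 else 1) * walsh S x := by
  unfold walsh flipSign
  split_ifs with h
  · rw [← Finset.mul_prod_erase S _ h, ← Finset.mul_prod_erase S _ h]
    rw [Finset.prod_congr rfl fun j hj => by
      rw [Function.update_of_ne (Finset.ne_of_mem_erase hj)]]
    simp
  · rw [one_mul]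
    refine Finset.prod_congr rfl fun j hj => ?_
    rw [Function.update_of_ne (ne_of_mem_of_not_mem hj h)]

variable [Fintype ι]

/-- The Walsh coefficient of a function on the sign cube. -/
def walshCoeff (f : (ι → ℤˣ) → ℝ) (S : Finset ι) : ℝ := 𝔼 x, f x * walsh S x

theorem expect_flipSign (i : ι) (f : (ι → ℤˣ) → ℝ) : 𝔼 x, f (flipSign i x) = 𝔼 x, f x :=
  Fintype.expect_equiv (flipSignEquiv i) _ _ fun _ => rfl

/-- The sum expands `∏ i, (1 + x i * y i)`, whose factors are all 2 when `x = y`, while one of them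
vanishes otherwise. -/
theorem sum_walsh_mul_walsh (x y : ι → ℤˣ) :
    ∑ S : Finset ι, walsh S x * walsh S y = if x = y then (Fintype.card (ι → ℤˣ) : ℝ) else 0 := by
  have h : ∑ S : Finset ι, walsh S x * walsh S y =
      ∏ i, (1 + ((x i : ℤ) : ℝ) * ((y i : ℤ) : ℝ)) := by
    rw [Finset.prod_one_add, Finset.powerset_univ]
    exact Finset.sum_congr rfl fun S _ => Finset.prod_mul_distrib.symm
  rw [h]
  split_ifs with hxy
  · subst hxy
    simp only [signCast_mul_self]
    norm_num
  · obtain ⟨i, hi⟩ := Function.ne_iff.1 hxy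
    refine Finset.prod_eq_zero (Finset.mem_univ i) ?_
    rcases Int.units_eq_one_or (x i) with h1 | h1 <;>
      rcases Int.units_eq_one_or (y i) with h2 | h2 <;> simp_all

/-- Parseval's identity, obtained from orthogonality in the points of the cube rather than in the
sets `S`. -/
theorem sum_walshCoeff_mul (f g : (ι → ℤˣ) → ℝ) :
    ∑ S, walshCoeff f S * walshCoeff g S = 𝔼 x, f x * g x := by
  have hc : (Fintype.card (ι → ℤˣ) : ℝ) ≠ 0 := Nat.cast_ne_zero.2 Fintype.card_ne_zero
  simp only [walshCoeff, Fintype.expect_eq_sum_div_card, div_mul_div_comm]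
  rw [← Finset.sum_div, div_eq_div_iff (mul_ne_zero hc hc) hc]
  have h : ∑ S : Finset ι, (∑ x, f x * walsh S x) * ∑ x, g x * walsh S x =
      (∑ x, f x * g x) * (Fintype.card (ι → ℤˣ) : ℝ) := by
    simp only [Finset.sum_mul_sum]
    rw [Finset.sum_comm, Finset.sum_mul]
    refine Finset.sum_congr rfl fun x _ => ?_
    rw [Finset.sum_comm]
    have : ∀ y, ∑ S : Finset ι, f x * walsh S x * (g y * walsh S y) =
        if x = y then f x * g y * (Fintype.card (ι → ℤˣ) : ℝ) else 0 := fun y => by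
      rw [← mul_ite_zero, ← sum_walsh_mul_walsh, Finset.mul_sum]
      exact Finset.sum_congr rfl fun S _ => by ring
    simp [this]
  rw [h, mul_assoc]

theorem walshCoeff_comp_flipSign (f : (ι → ℤˣ) → ℝ) (i : ι) (S : Finset ι) :
    walshCoeff (fun x => f (flipSign i x)) S = (if i ∈ S then -1 else 1) * walshCoeff f S := by
  unfold walshCoeff
  rw [← expect_flipSign i, Finset.mul_expect]
  refine Finset.expect_congr rfl fun x _ => ?_
  simp only [flipSign_flipSign, walsh_flipSign]
  ring

theorem walshCoeff_eq_zero_of_even {f : (ι → ℤˣ) → ℝ} (hf : ∀ x, f (-x) = f x) {S : Finset ι}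
    (hS : Odd S.card) : walshCoeff f S = 0 := by
  have h : walshCoeff f S = -walshCoeff f S := by
    conv_lhs => unfold walshCoeff
    rw [← Fintype.expect_equiv (Equiv.neg (ι → ℤˣ)) (fun x => f (-x) * walsh S (-x)) _
      fun _ => rfl, walshCoeff, ← Finset.expect_neg_distrib]
    refine Finset.expect_congr rfl fun x _ => ?_
    rw [hf, walsh_neg, hS.neg_one_pow]
    ring
  linarith

theorem walshCoeff_empty (f : (ι → ℤˣ) → ℝ) : walshCoeff f ∅ = 𝔼 x, f x := by
  simp [walshCoeff, walsh]

/-- A reverse Hölder inequality on the sign cube, for even nonnegative functions that are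
superharmonic in the appropriate sense. -/
theorem expect_sq_le_two_mul_sq_expect {f : (ι → ℤˣ) → ℝ} (hf0 : ∀ x, 0 ≤ f x)
    (hf : ∀ x, f (-x) = f x)
    (hflip : ∀ x, ((Fintype.card ι : ℝ) - 2) * f x ≤ ∑ i, f (flipSign i x)) :
    𝔼 x, f x ^ 2 ≤ 2 * (𝔼 x, f x) ^ 2 := by
  -- The hypothesis `hflip` is multiplied by `f` and averaged. Each flip in a coordinate of `S`
  -- negates the coefficient at `S`, so the sum of all flips acts on it as `card ι - 2 * S.card`.
  have h1 : ((Fintype.card ι : ℝ) - 2) * ∑ S, walshCoeff f S ^ 2 ≤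
      ∑ S : Finset ι, ((Fintype.card ι : ℝ) - 2 * S.card) * walshCoeff f S ^ 2 := by
    have e1 : ((Fintype.card ι : ℝ) - 2) * ∑ S, walshCoeff f S ^ 2 =
        𝔼 x, f x * (((Fintype.card ι : ℝ) - 2) * f x) := by
      simp only [sq]
      rw [sum_walshCoeff_mul, Finset.mul_expect]
      exact Finset.expect_congr rfl fun x _ => by ring
    have e2 : ∑ S : Finset ι, ((Fintype.card ι : ℝ) - 2 * S.card) * walshCoeff f S ^ 2 =
        𝔼 x, f x * ∑ i, f (flipSign i x) := by
      simp only [Finset.mul_sum]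
      rw [Finset.expect_sum_comm]
      simp only [← sum_walshCoeff_mul, walshCoeff_comp_flipSign]
      rw [Finset.sum_comm]
      refine Finset.sum_congr rfl fun S _ => ?_
      have : ∑ i, (if i ∈ S then (-1 : ℝ) else 1) = (Fintype.card ι : ℝ) - 2 * S.card := by
        have : ∀ i, (if i ∈ S then (-1 : ℝ) else 1) = 1 - 2 * (if i ∈ S then 1 else 0) := by
          intro i; split_ifs <;> norm_num
        simp only [this, Finset.sum_sub_distrib, ← Finset.mul_sum]
        simp
      rw [← this, Finset.sum_mul]
      exact Finset.sum_congr rfl fun i _ => by ring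
    rw [e1, e2]
    exact Finset.expect_le_expect fun x _ => mul_le_mul_of_nonneg_left (hflip x) (hf0 x)
  -- Evenness removes the level `S.card = 1`, and above it `S.card - 1 ≥ 1`. Only `S = ∅` has a
  -- negative factor, -1, which the correction `-2 * walshCoeff f S ^ 2` accounts for; it becomes
  -- the factor 2 in the conclusion.
  have h2 : ∀ S : Finset ι, walshCoeff f S ^ 2 + (if S = ∅ then -2 * walshCoeff f S ^ 2 else 0) ≤
      ((S.card : ℝ) - 1) * walshCoeff f S ^ 2 := by
    intro S
    rcases Nat.lt_or_ge S.card 2 with h | h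
    · interval_cases hc : S.card
      · rw [if_pos (Finset.card_eq_zero.1 hc)]
        push_cast
        linarith
      · rw [walshCoeff_eq_zero_of_even hf (by rw [hc]; exact odd_one)]
        simp
    · rw [if_neg (by rintro rfl; simp at h), add_zero]
      have : (2 : ℝ) ≤ S.card := by exact_mod_cast h
      nlinarith [sq_nonneg (walshCoeff f S)]
  have h3 := Finset.sum_le_sum fun S (_ : S ∈ Finset.univ) => h2 S
  rw [Finset.sum_add_distrib, Finset.sum_ite_eq' Finset.univ ∅, if_pos (Finset.mem_univ _)] at h3
  have h4 : ∑ S : Finset ι, ((S.card : ℝ) - 1) * walshCoeff f S ^ 2 ≤ 0 := by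
    have : ∑ S : Finset ι, ((Fintype.card ι : ℝ) - 2 * S.card) * walshCoeff f S ^ 2 =
        ((Fintype.card ι : ℝ) - 2) * ∑ S, walshCoeff f S ^ 2 -
          2 * ∑ S : Finset ι, ((S.card : ℝ) - 1) * walshCoeff f S ^ 2 := by
      simp only [Finset.mul_sum, ← Finset.sum_sub_distrib]
      exact Finset.sum_congr rfl fun S _ => by ring
    linarith
  have h5 : ∑ S, walshCoeff f S ^ 2 = 𝔼 x, f x ^ 2 := by
    simp only [sq]
    exact sum_walshCoeff_mul f f
  rw [walshCoeff_empty] at h3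
  linarith

end Walsh

/-! ### Kahane's inequality for signed sums -/

section SignSum

variable {ι : Type*} [Fintype ι] [DecidableEq ι]

/-- The signed sum `∑ i, x i • v i`. -/
def signSum {E : Type*} [AddCommGroup E] [Module ℝ E] (v : ι → E) (x : ι → ℤˣ) : E :=
  ∑ i, ((x i : ℤ) : ℝ) • v i

theorem signSum_flipSign {E : Type*} [AddCommGroup E] [Module ℝ E] (v : ι → E) (i : ι)
    (x : ι → ℤˣ) :
    signSum v (flipSign i x) = signSum v x - (2 * ((x i : ℤ) : ℝ)) • v i := by
  unfold signSum flipSign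
  rw [← Finset.add_sum_erase _ _ (Finset.mem_univ i),
    ← Finset.add_sum_erase _ (fun j => ((x j : ℤ) : ℝ) • v j) (Finset.mem_univ i),
    Finset.sum_congr rfl fun j hj => by
      rw [Function.update_of_ne (Finset.ne_of_mem_erase hj)]]
  simp only [Function.update_self, Units.val_neg, Int.cast_neg]
  module

/-- The Kahane inequality between the first and second moments, with the optimal constant. -/
theorem expect_sq_norm_signSum_le {E : Type*} [NormedAddCommGroup E] [NormedSpace ℝ E]
    (v : ι → E) :
    𝔼 x, ‖signSum v x‖ ^ 2 ≤ 2 * (𝔼 x, ‖signSum v x‖) ^ 2 := by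
  refine expect_sq_le_two_mul_sq_expect (fun x => norm_nonneg _) (fun x => ?_) fun x => ?_
  · rw [← norm_neg]
    congr 1
    simp [signSum]
  -- The flip of coordinate `i` subtracts twice the `i`-th term, so all flips together subtract
  -- twice the whole sum. The triangle inequality then gives the lower bound on flips.
  · have h : ∑ i, signSum v (flipSign i x) = ((Fintype.card ι : ℝ) - 2) • signSum v x := by
      simp only [signSum_flipSign, Finset.sum_sub_distrib, mul_smul, ← Finset.smul_sum]
      rw [← signSum, Finset.sum_const, Finset.card_univ, sub_smul, Nat.cast_smul_eq_nsmul]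
    calc ((Fintype.card ι : ℝ) - 2) * ‖signSum v x‖
        ≤ |(Fintype.card ι : ℝ) - 2| * ‖signSum v x‖ :=
          mul_le_mul_of_nonneg_right (le_abs_self _) (norm_nonneg _)
      _ = ‖∑ i, signSum v (flipSign i x)‖ := by rw [h, norm_smul, Real.norm_eq_abs]
      _ ≤ _ := norm_sum_le _ _

/-- A signed sum and its flip at `i` differ by `±2 • v i`, and the flip preserves the mean. -/
theorem norm_le_expect_norm_signSum {E : Type*} [NormedAddCommGroup E] [NormedSpace ℝ E]
    (v : ι → E) (i : ι) : ‖v i‖ ≤ 𝔼 x, ‖signSum v x‖ := by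
  have h : ∀ x : ι → ℤˣ, 2 * ‖v i‖ ≤ ‖signSum v x‖ + ‖signSum v (flipSign i x)‖ := fun x => by
    refine le_trans (le_of_eq ?_) (norm_sub_le _ _)
    rw [signSum_flipSign, sub_sub_cancel, norm_smul]
    rcases Int.units_eq_one_or (x i) with h | h <;> simp [h]
  have h2 := Finset.expect_le_expect fun x (_ : x ∈ Finset.univ) => h x
  rw [Finset.expect_add_distrib, expect_flipSign i fun x => ‖signSum v x‖,
    Fintype.expect_const] at h2
  linarith

theorem expect_sq_norm_signSum {H : Type*} [NormedAddCommGroup H] [InnerProductSpace ℝ H]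
    (v : ι → H) : 𝔼 x, ‖signSum v x‖ ^ 2 = ∑ i, ‖v i‖ ^ 2 := by
  have horth : ∀ i j, 𝔼 x : ι → ℤˣ, ((x i : ℤ) : ℝ) * ((x j : ℤ) : ℝ) =
      if i = j then 1 else 0 := by
    intro i j
    split_ifs with h
    · subst h
      simp [signCast_mul_self]
    · have := expect_flipSign i fun x : ι → ℤˣ => ((x i : ℤ) : ℝ) * ((x j : ℤ) : ℝ)
      simp only [flipSign, Function.update_self, Function.update_of_ne (Ne.symm h), Units.val_neg,
        Int.cast_neg, neg_mul, Finset.expect_neg_distrib] at this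
      linarith
  have h : ∀ x : ι → ℤˣ, ‖signSum v x‖ ^ 2 =
      ∑ i, ∑ j, ((x i : ℤ) : ℝ) * ((x j : ℤ) : ℝ) * inner ℝ (v i) (v j) := fun x => by
    rw [← real_inner_self_eq_norm_sq, signSum, sum_inner]
    refine Finset.sum_congr rfl fun i _ => ?_
    rw [inner_sum]
    refine Finset.sum_congr rfl fun j _ => ?_
    rw [real_inner_smul_left, real_inner_smul_right, mul_assoc]
  simp only [h, Finset.expect_sum_comm, ← Finset.expect_mul, horth]
  simp

end SignSum

/-! ### Multilinear signed sums -/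

section SignChaos

variable {ι : Type*} [Fintype ι]

/-- The multilinear signed sum `∑ i, (∏ j, x j (i j)) • y i`. -/
def signChaos {E : Type*} [AddCommGroup E] [Module ℝ E] {m : ℕ} (y : (Fin m → ι) → E)
    (x : Fin m → ι → ℤˣ) : E :=
  ∑ i, (∏ j, ((x j (i j) : ℤ) : ℝ)) • y i

theorem signChaos_cons {E : Type*} [AddCommGroup E] [Module ℝ E] {m : ℕ}
    (y : (Fin (m + 1) → ι) → E) (e : ι → ℤˣ) (x : Fin m → ι → ℤˣ) :
    signChaos y (Fin.cons e x : Fin (m + 1) → ι → ℤˣ) =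
      signChaos (fun i => signSum (fun a => y (Fin.cons a i)) e) x := by
  unfold signChaos signSum
  rw [← (Fin.consEquiv fun _ => ι).sum_comp, Fintype.sum_prod_type, Finset.sum_comm]
  refine Finset.sum_congr rfl fun i _ => ?_
  rw [Finset.smul_sum]
  refine Finset.sum_congr rfl fun a _ => ?_
  simp [Fin.consEquiv, Fin.prod_univ_succ, smul_smul, mul_comm]

variable [DecidableEq ι]

/-- The mean of the norm of the multilinear signed sum over all choices of signs. -/
def signChaosMean {E : Type*} [NormedAddCommGroup E] [NormedSpace ℝ E] {m : ℕ}
    (y : (Fin m → ι) → E) : ℝ :=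
  𝔼 x : Fin m → ι → ℤˣ, ‖signChaos y x‖

theorem signChaosMean_nonneg {E : Type*} [NormedAddCommGroup E] [NormedSpace ℝ E] {m : ℕ}
    (y : (Fin m → ι) → E) : 0 ≤ signChaosMean y :=
  Finset.expect_nonneg fun _ _ => norm_nonneg _

theorem signChaosMean_zero {E : Type*} [NormedAddCommGroup E] [NormedSpace ℝ E]
    (y : (Fin 0 → ι) → E) : signChaosMean y = ‖y default‖ := by
  simp [signChaosMean, signChaos]

theorem signChaosMean_succ {E : Type*} [NormedAddCommGroup E] [NormedSpace ℝ E] {m : ℕ}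
    (y : (Fin (m + 1) → ι) → E) :
    signChaosMean y =
      𝔼 e : ι → ℤˣ, signChaosMean fun i => signSum (fun a => y (Fin.cons a i)) e := by
  unfold signChaosMean
  simp only [← signChaos_cons]
  rw [← Fintype.expect_equiv (Fin.consEquiv fun _ => ι → ℤˣ)
    (fun p => ‖signChaos y (Fin.cons p.1 p.2 : Fin (m + 1) → ι → ℤˣ)‖) _ fun _ => rfl,
    ← Finset.univ_product_univ, Finset.expect_product]

/-- The endpoint at infinity: the one-variable bound is applied to one index at a time. -/
theorem norm_le_signChaosMean {E : Type*} [NormedAddCommGroup E] [NormedSpace ℝ E] {m : ℕ}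
    (y : (Fin m → ι) → E) (i : Fin m → ι) : ‖y i‖ ≤ signChaosMean y := by
  induction m with
  | zero => rw [signChaosMean_zero, Subsingleton.elim i default]
  | succ m ih =>
    rw [signChaosMean_succ]
    calc ‖y i‖ = ‖y (Fin.cons (i 0) (Fin.tail i))‖ := by rw [Fin.cons_self_tail]
      _ ≤ 𝔼 e, ‖signSum (fun a => y (Fin.cons a (Fin.tail i))) e‖ :=
        norm_le_expect_norm_signSum (fun a => y (Fin.cons a (Fin.tail i))) (i 0)
      _ ≤ _ := Finset.expect_le_expect fun e _ =>
        ih (fun i => signSum (fun a => y (Fin.cons a i)) e) (Fin.tail i)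

theorem sum_sq_norm_le_signChaosMean {H : Type*} [NormedAddCommGroup H] [InnerProductSpace ℝ H]
    {m : ℕ} (y : (Fin m → ι) → H) : ∑ i, ‖y i‖ ^ 2 ≤ 2 ^ m * signChaosMean y ^ 2 := by
  induction m with
  | zero => simp [signChaosMean_zero]
  | succ m ih =>
    -- The slice with first index `a`, as one vector of an ℓ² sum, so that Kahane's inequality
    -- applies to all remaining indices at once.
    let F : ι → PiLp 2 fun _ : Fin m → ι => H := fun a => WithLp.toLp 2 fun i => y (Fin.cons a i)
    have hF : ∀ e : ι → ℤˣ, ‖signSum F e‖ ^ 2 =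
        ∑ i, ‖signSum (fun a => y (Fin.cons a i)) e‖ ^ 2 := fun e => by
      rw [PiLp.norm_sq_eq_of_L2]
      simp [signSum, F]
    -- The induction hypothesis is used for each fixed choice `e` of the first signs, and averaged
    -- over `e` only afterwards.
    have hle : ∀ e : ι → ℤˣ, ‖signSum F e‖ ≤
        √(2 ^ m) * signChaosMean fun i => signSum (fun a => y (Fin.cons a i)) e := fun e => by
      refine le_of_sq_le_sq ?_ (mul_nonneg (Real.sqrt_nonneg _) (signChaosMean_nonneg _))
      rw [hF, mul_pow, Real.sq_sqrt (by positivity)]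
      exact ih _
    have hmean : 𝔼 e, ‖signSum F e‖ ≤ √(2 ^ m) * signChaosMean y := by
      rw [signChaosMean_succ, Finset.mul_expect]
      exact Finset.expect_le_expect fun e _ => hle e
    calc ∑ i, ‖y i‖ ^ 2 = ∑ a, ‖F a‖ ^ 2 := by
          rw [← (Fin.consEquiv fun _ => ι).sum_comp, Fintype.sum_prod_type]
          refine Finset.sum_congr rfl fun a _ => ?_
          rw [PiLp.norm_sq_eq_of_L2]
          rfl
      _ = 𝔼 e, ‖signSum F e‖ ^ 2 := (expect_sq_norm_signSum F).symm
      _ ≤ 2 * (𝔼 e, ‖signSum F e‖) ^ 2 := expect_sq_norm_signSum_le F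
      _ ≤ 2 * (√(2 ^ m) * signChaosMean y) ^ 2 := by
          gcongr
      _ = 2 ^ (m + 1) * signChaosMean y ^ 2 := by
          rw [mul_pow, Real.sq_sqrt (by positivity)]
          ring

/-- The extremal case: each index contributes the factor `e 0 + e 1`, which is 0 half of the time
and ±2 otherwise, so its mean absolute value is 1. -/
theorem signChaosMean_const {E : Type*} [NormedAddCommGroup E] [NormedSpace ℝ E] (m : ℕ) (v : E) :
    signChaosMean (fun _ : Fin m → Fin 2 => v) = ‖v‖ := by
  induction m generalizing v with
  | zero => exact signChaosMean_zero _
  | succ m ih =>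
    rw [signChaosMean_succ]
    simp only [ih]
    have h : ∀ e : Fin 2 → ℤˣ, ‖signSum (fun _ => v) e‖ =
        |((e 0 : ℤ) : ℝ) + ((e 1 : ℤ) : ℝ)| * ‖v‖ := fun e => by
      rw [signSum, Fin.sum_univ_two, ← add_smul, norm_smul, Real.norm_eq_abs]
    simp only [h, ← Finset.expect_mul]
    have h2 : 𝔼 e : Fin 2 → ℤˣ, |((e 0 : ℤ) : ℝ) + ((e 1 : ℤ) : ℝ)| = 1 := by
      rw [← Fintype.expect_equiv (finTwoArrowEquiv ℤˣ).symm
        (fun p => |((p.1 : ℤ) : ℝ) + ((p.2 : ℤ) : ℝ)|) _ fun p => by simp,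
        Fintype.expect_eq_sum_div_card, Fintype.sum_prod_type]
      simp only [show (Finset.univ : Finset ℤˣ) = {1, -1} from rfl]
      norm_num [Fintype.card_prod]
    rw [h2, one_mul]

end SignChaos

/-! ### Binary digits as independent signs -/

section Digits

/-- The sign determined by the `(k + 1)`-st binary digit of `t`. -/
def digitSign (k : ℕ) (t : ℝ) : ℤˣ := if Int.fract (2 ^ k * t) < 1 / 2 then 1 else -1

theorem rademacher_eq_digitSign {k : ℕ} {t : ℝ} (h0 : Int.fract (2 ^ k * t) ≠ 0)
    (h1 : Int.fract (2 ^ k * t) ≠ 1 / 2) : rademacher (k + 1) t = ((digitSign k t : ℤ) : ℝ) := by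
  set s := Int.fract ((2 : ℝ) ^ k * t) with hs
  have hs0 : 0 < s := lt_of_le_of_ne (Int.fract_nonneg _) h0.symm
  have hs1 : s < 1 := Int.fract_lt_one _
  have hsin : Real.sin ((2 : ℝ) ^ (k + 1) * Real.pi * t) = Real.sin (2 * Real.pi * s) := by
    rw [show (2 : ℝ) ^ (k + 1) * Real.pi * t =
      2 * Real.pi * s + (⌊(2 : ℝ) ^ k * t⌋ : ℤ) * (2 * Real.pi) by
        rw [hs, Int.fract]
        ring, Real.sin_add_int_mul_two_pi]
  rw [rademacher, hsin, digitSign, ← hs]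
  rcases lt_or_gt_of_ne h1 with h | h
  · rw [if_pos h, Real.sign_of_pos]
    · simp
    · refine Real.sin_pos_of_pos_of_lt_pi (by positivity) ?_
      nlinarith [Real.pi_pos]
  · rw [if_neg h.not_gt, Real.sign_of_neg]
    · simp
    · rw [← Real.sin_sub_two_pi]
      refine Real.sin_neg_of_neg_of_neg_pi_lt ?_ ?_ <;> nlinarith [Real.pi_pos]

theorem ae_rademacher_eq_digitSign (k : ℕ) :
    ∀ᵐ t : ℝ, rademacher (k + 1) t = ((digitSign k t : ℤ) : ℝ) := by
  have h : (Set.range fun z : ℤ => (z : ℝ) / 2 ^ (k + 1)).Countable := Set.countable_range _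
  filter_upwards [h.ae_notMem volume] with t ht
  -- The sine vanishes only when `2 ^ k * t` is an integer or a half-integer, that is, when `t` is
  -- an even or odd multiple of `1 / 2 ^ (k + 1)`.
  refine rademacher_eq_digitSign (fun h0 => ht ⟨2 * ⌊(2 : ℝ) ^ k * t⌋, ?_⟩)
    fun h1 => ht ⟨2 * ⌊(2 : ℝ) ^ k * t⌋ + 1, ?_⟩
  · rw [Int.fract] at h0
    simp only
    push_cast
    rw [div_eq_iff (by positivity), pow_succ]
    linarith
  · rw [Int.fract] at h1
    simp only
    push_cast
    rw [div_eq_iff (by positivity), pow_succ]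
    linarith

/-- The points of `[0, 1)` with prescribed first binary digits. -/
def digitCylinder {n : ℕ} (e : Fin n → ℤˣ) : Set ℝ :=
  {t | t ∈ Set.Ico (0 : ℝ) 1 ∧ ∀ k : Fin n, digitSign k t = e k}

theorem digitSign_succ (k : ℕ) (t : ℝ) : digitSign (k + 1) t = digitSign k (2 * t) := by
  rw [digitSign, digitSign, pow_succ, mul_assoc]

theorem digitSign_sub_one (k : ℕ) (t : ℝ) : digitSign k (t - 1) = digitSign k t := by
  have h : (2 : ℝ) ^ k * (t - 1) = 2 ^ k * t - ((2 ^ k : ℤ) : ℝ) := by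
    push_cast
    ring
  rw [digitSign, digitSign, h, Int.fract_sub_intCast]

theorem digitSign_zero {t : ℝ} (ht : t ∈ Set.Ico (0 : ℝ) 1) :
    digitSign 0 t = if t < 1 / 2 then 1 else -1 := by
  rw [digitSign, pow_zero, one_mul, Int.fract_eq_self.2 ht]

theorem digitCylinder_succ_of_one {n : ℕ} {e : Fin (n + 1) → ℤˣ} (h : e 0 = 1) :
    digitCylinder e = (fun t => 2 * t) ⁻¹' digitCylinder (Fin.tail e) := by
  ext t
  simp only [digitCylinder, Set.mem_ofPred_eq, Set.mem_preimage, Fin.forall_fin_succ, h,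
    Fin.val_zero, Fin.val_succ, digitSign_succ, Fin.tail]
  constructor
  · rintro ⟨ht, h0, hk⟩
    rw [digitSign_zero ht] at h0
    have : t < 1 / 2 := by
      by_contra hc
      rw [if_neg hc] at h0
      exact absurd h0 (by decide)
    exact ⟨⟨by linarith [ht.1], by linarith⟩, hk⟩
  · rintro ⟨⟨h0, h1⟩, hk⟩
    have ht : t ∈ Set.Ico (0 : ℝ) 1 := ⟨by linarith, by linarith⟩
    exact ⟨ht, by rw [digitSign_zero ht, if_pos (by linarith)], hk⟩

theorem digitCylinder_succ_of_neg_one {n : ℕ} {e : Fin (n + 1) → ℤˣ} (h : e 0 = -1) :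
    digitCylinder e = (fun t => 2 * t) ⁻¹' ((fun t => t - 1) ⁻¹' digitCylinder (Fin.tail e)) := by
  ext t
  simp only [digitCylinder, Set.mem_ofPred_eq, Set.mem_preimage, Fin.forall_fin_succ, h,
    Fin.val_zero, Fin.val_succ, digitSign_succ, Fin.tail, digitSign_sub_one]
  constructor
  · rintro ⟨ht, h0, hk⟩
    rw [digitSign_zero ht] at h0
    have : 1 / 2 ≤ t := by
      by_contra hc
      rw [if_pos (not_le.1 hc)] at h0
      exact absurd h0 (by decide)
    exact ⟨⟨by linarith, by linarith [ht.2]⟩, hk⟩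
  · rintro ⟨⟨h0, h1⟩, hk⟩
    have ht : t ∈ Set.Ico (0 : ℝ) 1 := ⟨by linarith, by linarith⟩
    exact ⟨ht, by rw [digitSign_zero ht, if_neg (by linarith)], hk⟩

theorem digitCylinder_of_fin_zero (e : Fin 0 → ℤˣ) : digitCylinder e = Set.Ico 0 1 := by
  ext t
  simp [digitCylinder]

/-- Doubling shifts the digits, so each prescribed digit makes the cylinder a preimage under
doubling (up to a translation by 1), which halves the measure. -/
theorem volume_digitCylinder {n : ℕ} (e : Fin n → ℤˣ) :
    volume (digitCylinder e) = ENNReal.ofReal ((1 / 2) ^ n) := by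
  induction n with
  | zero => simp [digitCylinder_of_fin_zero]
  | succ n ih =>
    have h2 : ∀ s : Set ℝ, volume s = ENNReal.ofReal ((1 / 2) ^ n) →
        volume ((fun t : ℝ => 2 * t) ⁻¹' s) = ENNReal.ofReal ((1 / 2) ^ (n + 1)) := fun s hs => by
      rw [Real.volume_preimage_mul_left two_ne_zero, hs, ← ENNReal.ofReal_mul (abs_nonneg _)]
      congr 1
      rw [abs_of_pos (by norm_num)]
      ring
    rcases Int.units_eq_one_or (e 0) with h | h
    · rw [digitCylinder_succ_of_one h]
      exact h2 _ (ih _)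
    · rw [digitCylinder_succ_of_neg_one h]
      refine h2 _ ?_
      simpa only [sub_eq_add_neg, measure_preimage_add_right] using ih _

theorem measurableSet_digitCylinder {n : ℕ} (e : Fin n → ℤˣ) :
    MeasurableSet (digitCylinder e) := by
  induction n with
  | zero => simp [digitCylinder_of_fin_zero]
  | succ n ih =>
    rcases Int.units_eq_one_or (e 0) with h | h
    · rw [digitCylinder_succ_of_one h]
      exact (ih _).preimage (by fun_prop)
    · rw [digitCylinder_succ_of_neg_one h]
      exact ((ih _).preimage (by fun_prop)).preimage (by fun_prop)

/-- Up to a null set, the cube is partitioned into boxes of digit cylinders, all of the same volume,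
and the integrand is constant on each box. -/
theorem setIntegral_digitSign {m n : ℕ} (G : (Fin m → Fin n → ℤˣ) → ℝ) :
    ∫ t in (Set.Icc 0 1 : Set (Fin m → ℝ)), G (fun j k => digitSign k (t j)) = 𝔼 x, G x := by
  have hu : (Set.univ.pi fun _ : Fin m => Set.Ico (0 : ℝ) 1) =
      ⋃ x : Fin m → Fin n → ℤˣ, Set.univ.pi fun j => digitCylinder (x j) := by
    ext t
    simp only [Set.mem_univ_pi, Set.mem_iUnion, digitCylinder, Set.mem_ofPred_eq]
    exact ⟨fun h => ⟨fun j k => digitSign k (t j), fun j => ⟨h j, fun _ => rfl⟩⟩,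
      fun ⟨x, hx⟩ j => (hx j).1⟩
  have hG : ∀ x : Fin m → Fin n → ℤˣ, Set.EqOn (fun t : Fin m → ℝ =>
      G (fun j k => digitSign k (t j))) (fun _ => G x) (Set.univ.pi fun j => digitCylinder (x j)) :=
    fun x t ht => congrArg G (funext fun j => funext (ht j trivial).2)
  have hms : ∀ x : Fin m → Fin n → ℤˣ,
      MeasurableSet (Set.univ.pi fun j => digitCylinder (x j)) :=
    fun x => MeasurableSet.univ_pi fun j => measurableSet_digitCylinder _
  have hvol : ∀ x : Fin m → Fin n → ℤˣ,
      volume (Set.univ.pi fun j => digitCylinder (x j)) =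
        ENNReal.ofReal (((1 / 2) ^ n) ^ m) := fun x => by
    rw [volume_pi_pi]
    simp_rw [volume_digitCylinder]
    rw [Finset.prod_const, Finset.card_univ, Fintype.card_fin, ENNReal.ofReal_pow (p := (1 / 2) ^ n) (by positivity)]
  have hae : (Set.univ.pi fun _ : Fin m => Set.Ico (0 : ℝ) 1) =ᵐ[volume]
      (Set.Icc 0 1 : Set (Fin m → ℝ)) := Measure.univ_pi_Ico_ae_eq_Icc
  rw [← setIntegral_congr_set hae, hu, integral_iUnion_fintype hms]
  · rw [Fintype.expect_eq_sum_div_card, Finset.sum_div]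
    refine Finset.sum_congr rfl fun x _ => ?_
    rw [setIntegral_congr_fun (hms x) (hG x), setIntegral_const, measureReal_def, hvol,
      ENNReal.toReal_ofReal (by positivity)]
    simp [div_eq_inv_mul]
  · intro x x' hne
    refine Set.disjoint_left.2 fun t ht ht' => hne ?_
    funext j k
    rw [← (ht j trivial).2 k, (ht' j trivial).2 k]
  · intro x
    refine IntegrableOn.congr_fun ?_ (hG x).symm (hms x)
    exact integrableOn_const (by rw [hvol]; exact ENNReal.ofReal_ne_top)

end Digits

/-! ### Interpolation and the final inequality -/

section Main

theorem rademacherChaosL1_eq_signChaosMean {𝕜 : Type*} [RCLike 𝕜] {Y : Type*}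
    [NormedAddCommGroup Y] [InnerProductSpace 𝕜 Y] [NormedSpace ℝ Y] [IsScalarTower ℝ 𝕜 Y]
    {m n : ℕ} (y : (Fin m → Fin n) → Y) : rademacherChaosL1 𝕜 y = signChaosMean y := by
  have h : ∀ᵐ t : Fin m → ℝ, ∀ (j : Fin m) (k : Fin n),
      rademacher (k + 1) (t j) = ((digitSign k (t j) : ℤ) : ℝ) := by
    rw [ae_all_iff]
    intro j
    rw [ae_all_iff]
    intro k
    exact (Measure.quasiMeasurePreserving_eval (fun _ : Fin m => (volume : Measure ℝ)) j).ae
      (ae_rademacher_eq_digitSign k)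
  rw [rademacherChaosL1, signChaosMean, ← setIntegral_digitSign]
  refine integral_congr_ae (ae_restrict_of_ae ?_)
  filter_upwards [h] with t ht
  simp only [rademacherChaos, signChaos, ht, RCLike.real_smul_eq_coe_smul (K := 𝕜)]

/-- Interpolation: the power `r - 2` of each norm is absorbed by the sup bound, leaving the square
sum. -/
theorem sum_norm_rpow_le {H : Type*} [NormedAddCommGroup H] [InnerProductSpace ℝ H]
    {ι : Type*} [Fintype ι] [DecidableEq ι] {m : ℕ} {r : ℝ} (hr : 2 ≤ r) (y : (Fin m → ι) → H) :
    ∑ i, ‖y i‖ ^ r ≤ 2 ^ m * signChaosMean y ^ r := by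
  -- Both exponents are nonnegative, so the splitting also holds at `a = 0`, including `r = 2`,
  -- where `0 ^ 0 = 1`.
  have hsplit : ∀ a : ℝ, 0 ≤ a → a ^ r = a ^ (r - 2) * a ^ 2 := fun a ha => by
    rw [← Real.rpow_natCast a 2, ← Real.rpow_add_of_nonneg ha (by linarith) (by norm_num)]
    norm_num
  have hD := signChaosMean_nonneg y
  calc ∑ i, ‖y i‖ ^ r ≤ ∑ i, signChaosMean y ^ (r - 2) * ‖y i‖ ^ 2 := by
        refine Finset.sum_le_sum fun i _ => ?_
        rw [hsplit _ (norm_nonneg _)]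
        exact mul_le_mul_of_nonneg_right (Real.rpow_le_rpow (norm_nonneg _)
          (norm_le_signChaosMean y i) (by linarith)) (sq_nonneg _)
    _ ≤ signChaosMean y ^ (r - 2) * (2 ^ m * signChaosMean y ^ 2) := by
        rw [← Finset.mul_sum]
        gcongr
        exact sum_sq_norm_le_signChaosMean y
    _ = 2 ^ m * signChaosMean y ^ r := by
        rw [hsplit _ hD]
        ring

end Main

end

theorem mainTheorem4 {𝕜 : Type*} [RCLike 𝕜] {Y : Type*} [NormedAddCommGroup Y]
    [InnerProductSpace 𝕜 Y] [CompleteSpace Y]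
    (m : ℕ) (hm : 1 ≤ m) (r : ℝ) (hr : 2 ≤ r) :
    (∀ n : ℕ, 1 ≤ n → ∀ y : (Fin m → Fin n) → Y,
      arrayNorm r y ≤ (2 : ℝ) ^ ((m : ℝ) / r) * rademacherChaosL1 𝕜 y) ∧
    (Nontrivial Y → ∀ C : ℝ,
      (∀ n : ℕ, 1 ≤ n → ∀ y : (Fin m → Fin n) → Y,
        arrayNorm r y ≤ C * rademacherChaosL1 𝕜 y) →
      (2 : ℝ) ^ ((m : ℝ) / r) ≤ C) := by
  -- Only real signs occur as scalars, so restriction to ℝ loses nothing: the norm is unchanged.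
  let _ : InnerProductSpace ℝ Y := InnerProductSpace.rclikeToReal 𝕜 Y
  have : IsScalarTower ℝ 𝕜 Y := RestrictScalars.isScalarTower ℝ 𝕜 Y
  have hr0 : 0 < r := by linarith
  have hpow : ((2 : ℝ) ^ m) ^ (1 / r) = 2 ^ ((m : ℝ) / r) := by
    rw [← Real.rpow_natCast, ← Real.rpow_mul zero_le_two, mul_one_div]
  have hroot : ∀ a : ℝ, 0 ≤ a → (2 ^ m * a ^ r) ^ (1 / r) = 2 ^ ((m : ℝ) / r) * a := fun a ha => by
    rw [Real.mul_rpow (by positivity) (by positivity), hpow, one_div,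
      Real.rpow_rpow_inv ha hr0.ne']
  refine ⟨fun n _ y => ?_, fun _ C hC => ?_⟩
  · rw [rademacherChaosL1_eq_signChaosMean, ← hroot _ (signChaosMean_nonneg y), arrayNorm]
    exact Real.rpow_le_rpow (by positivity) (sum_norm_rpow_le hr y) (by positivity)
  · obtain ⟨v, hv⟩ := exists_ne (0 : Y)
    -- The constant array has `2 ^ m` equal entries and mean `‖v‖`, so it attains equality.
    have h := hC 2 one_le_two fun _ => v
    rw [rademacherChaosL1_eq_signChaosMean, signChaosMean_const, arrayNorm] at h
    simp only [Finset.sum_const, Finset.card_univ, Fintype.card_pi, Fintype.card_fin,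
      Finset.prod_const, nsmul_eq_mul, Nat.cast_pow, Nat.cast_ofNat] at h
    rw [hroot _ (norm_nonneg v)] at h
    exact le_of_mul_le_mul_right h (norm_pos_iff.2 hv)
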